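/- Let $\kappa_1>\kappa_2>0$, $0<\theta_1\le\theta_2$ with $\kappa_1\theta_1>\kappa_2\theta_2$, $\sigma>0$, $\lambda>0$, and assume $2\kappa_i\theta_i/\sigma^2\ge 1$ for $i=1,2$. Put $$\tilde D=\frac{\kappa_1\theta_1-\kappa_2\theta_2}{\kappa_1-\kappa_2}>0,\qquad a_i=\frac{\lambda}{\kappa_i},\qquad b_i=\frac{2\kappa_i\theta_i}{\sigma^2},\qquad x_i(D)=\frac{2\kappa_iD}{\sigma^2},\qquad L_i(D)=\frac{D}{\lambda+\kappa_i}+\frac{\theta_i\kappa_i}{\lambda(\lambda+\kappa_i)}\qquad(i=1,2).$$ Let $M(a,b,x)=\sum_{n\ge0}\frac{(a)_n}{(b)_n}\frac{x^n}{n!}$ (for $b>0$) and $U(a,b,x)=\frac1{\Gamma(a)}\int_0^\infty e^{-xt}t^{a-1}(1+t)^{b-a-1}\,dt$ (for $a>0$, $x>0$) be the confluent hypergeometric functions of the first and second kind. Put $$m_1=M(a_1,b_1,x_1(\tilde D)),\quad M_1=M(a_1+1,b_1+1,x_1(\tilde D)),\quad u_2=U(a_2,b_2,x_2(\tilde D)),\quad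 U_2=U(a_2+1,b_2+1,x_2(\tilde D)),$$ $$A=\frac{2m_1U_2}{\sigma^2}+\frac{M_1u_2}{\kappa_1\theta_1},$$ $$E=\frac{u_2(\kappa_1-\kappa_2)-\frac{2U_2\kappa_1\kappa_2(\theta_1-\theta_2)}{\sigma^2}}{\lambda(\lambda+\kappa_1)(\lambda+\kappa_2)A},\qquad F=\frac{M_1\kappa_2\frac{\theta_1-\theta_2}{\theta_1}+m_1(\kappa_1-\kappa_2)}{\lambda(\lambda+\kappa_1)(\lambda+\kappa_2)A},$$ and $$\Phi(D)=\begin{cases}L_1(D)+E\,M(a_1,b_1,x_1(D)), & 0<D\le\tilde D,\\ L_2(D)+F\,U(a_2,b_2,x_2(D)), & D>\tilde D.\end{cases}$$ Then $E>0$ and $F>0$, and $\Phi$ is the unique function $\varphi:(0,\infty)\to\mathbb R$ such that 1. $\varphi$ is positive, is of class $C^2$ on $(0,\infty)$, and satisfies for all $D>0$ $$\max\{\kappa_1(\theta_1-D),\kappa_2(\theta_2-D)\}\,\varphi'(D)+\tfrac12\sigma^2D\,\varphi''(D)-\lambda\varphi(D)+D=0;$$ 2. $\varphi$ has a finite value at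 $0$, that is, $\lim_{D\to0+}\varphi(D)$ exists and is finite; 3. $\varphi$ has linear growth at infinity, that is, $\varphi(D)=O(D)$ as $D\to\infty$. Moreover $\Phi$ is asymptotically linear: $\Phi(D)-L_2(D)\to0$ as $D\to\infty$. -/

import Mathlib

open Set Filter Topology Asymptotics MeasureTheory

noncomputable section

/-- Kummer's confluent hypergeometric function of the first kind,
`M(a, b, x) = ∑ n, (a)ₙ / (b)ₙ * x ^ n / n!`, where `(c)ₙ = c (c + 1) ⋯ (c + n - 1)`
(for `b > 0` the series converges at every real `x`). -/
def kummerM (a b x : ℝ) : ℝ :=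
  ∑' n : ℕ, (ascPochhammer ℝ n).eval a / (ascPochhammer ℝ n).eval b * x ^ n / (n.factorial : ℝ)

/-- The confluent hypergeometric function of the second kind (Tricomi's function), on the range
`a > 0`, `x > 0` and `b` an arbitrary real number (integers included):
`U(a, b, x) = (1 / Γ(a)) ∫₀^∞ exp(-x t) t^(a-1) (1 + t)^(b-a-1) dt`. The integral converges there. -/
def tricomiU (a b x : ℝ) : ℝ :=
  (Real.Gamma a)⁻¹ *
    ∫ t in Ioi (0 : ℝ), Real.exp (-(x * t)) * t ^ (a - 1) * (1 + t) ^ (b - a - 1)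

/-- The parameters of the model in which the two groups of investors agree on the volatility:
group `i` believes that the dividend rate follows `dD = κᵢ (θᵢ - D) dt + σ √D dB`, and
`lam` is the common discount rate. -/
structure DividendModel where
  κ₁ : ℝ
  κ₂ : ℝ
  θ₁ : ℝ
  θ₂ : ℝ
  σ : ℝ
  lam : ℝ

namespace DividendModel

variable (p : DividendModel)

/-- The threshold `D̃`, where the drifts `κ₁ (θ₁ - D)` and `κ₂ (θ₂ - D)` coincide. -/
def threshold : ℝ := (p.κ₁ * p.θ₁ - p.κ₂ * p.θ₂) / (p.κ₁ - p.κ₂)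

def a₁ : ℝ := p.lam / p.κ₁

def a₂ : ℝ := p.lam / p.κ₂

def b₁ : ℝ := 2 * p.κ₁ * p.θ₁ / p.σ ^ 2

def b₂ : ℝ := 2 * p.κ₂ * p.θ₂ / p.σ ^ 2

/-- `x₁` as a function of the dividend rate. -/
def x₁ (D : ℝ) : ℝ := 2 * p.κ₁ * D / p.σ ^ 2

/-- `x₂` as a function of the dividend rate. -/
def x₂ (D : ℝ) : ℝ := 2 * p.κ₂ * D / p.σ ^ 2

/-- The value of the asset for group 1 when it is never sold. -/
def intrinsic₁ (D : ℝ) : ℝ :=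
  D / (p.lam + p.κ₁) + p.θ₁ * p.κ₁ / (p.lam * (p.lam + p.κ₁))

/-- The value of the asset for group 2 when it is never sold. -/
def intrinsic₂ (D : ℝ) : ℝ :=
  D / (p.lam + p.κ₂) + p.θ₂ * p.κ₂ / (p.lam * (p.lam + p.κ₂))

/-- `m(D) = M(a₁, b₁, x₁)`. -/
def m (D : ℝ) : ℝ := kummerM p.a₁ p.b₁ (p.x₁ D)

/-- `u(D) = U(a₂, b₂, x₂)`. -/
def u (D : ℝ) : ℝ := tricomiU p.a₂ p.b₂ (p.x₂ D)

/-- `m₁ = M(a₁, b₁, x₁)` at the threshold. -/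
def m₁ : ℝ := kummerM p.a₁ p.b₁ (p.x₁ p.threshold)

/-- `M₁ = M(a₁ + 1, b₁ + 1, x₁)` at the threshold. -/
def M₁ : ℝ := kummerM (p.a₁ + 1) (p.b₁ + 1) (p.x₁ p.threshold)

/-- `u₂ = U(a₂, b₂, x₂)` at the threshold. -/
def u₂ : ℝ := tricomiU p.a₂ p.b₂ (p.x₂ p.threshold)

/-- `U₂ = U(a₂ + 1, b₂ + 1, x₂)` at the threshold. -/
def U₂ : ℝ := tricomiU (p.a₂ + 1) (p.b₂ + 1) (p.x₂ p.threshold)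

/-- The constant `A` in the denominators of `E` and `F`. -/
def A : ℝ := 2 * p.m₁ * p.U₂ / p.σ ^ 2 + p.M₁ * p.u₂ / (p.κ₁ * p.θ₁)

/-- The constant `E`. -/
def E : ℝ :=
  (p.u₂ * (p.κ₁ - p.κ₂) - 2 * p.U₂ * p.κ₁ * p.κ₂ * (p.θ₁ - p.θ₂) / p.σ ^ 2) /
    (p.lam * (p.lam + p.κ₁) * (p.lam + p.κ₂) * p.A)

/-- The constant `F`. -/
def F : ℝ :=
  (p.M₁ * p.κ₂ * ((p.θ₁ - p.θ₂) / p.θ₁) + p.m₁ * (p.κ₁ - p.κ₂)) /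
    (p.lam * (p.lam + p.κ₁) * (p.lam + p.κ₂) * p.A)

/-- The function `Φ`. -/
def Phi (D : ℝ) : ℝ :=
  if D ≤ p.threshold then p.intrinsic₁ D + p.E * p.m D else p.intrinsic₂ D + p.F * p.u D

/-- `φ` is a positive `C²` solution, on the dividend rates `D > 0`, of
`max {κ₁ (θ₁ - D), κ₂ (θ₂ - D)} φ' + ½ σ² D φ'' - lam φ + D = 0`
that has a finite value at `0` and at most linear growth at infinity.
Only the values of `φ` on `(0, ∞)` matter. -/
structure IsSolution (φ : ℝ → ℝ) : Prop where
  pos : ∀ D, 0 < D → 0 < φ D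
  contDiffOn : ContDiffOn ℝ 2 φ (Ioi 0)
  ode : ∀ D, 0 < D →
    max (p.κ₁ * (p.θ₁ - D)) (p.κ₂ * (p.θ₂ - D)) * deriv φ D
      + 1 / 2 * p.σ ^ 2 * D * deriv (deriv φ) D - p.lam * φ D + D = 0
  finite_at_zero : ∃ c : ℝ, Tendsto φ (𝓝[>] 0) (𝓝 c)
  linear_growth : φ =O[atTop] fun D : ℝ => D

end DividendModel

end

/-!
On each side of the threshold the drift is affine and the equation is linear. The affine function
`intrinsicᵢ` is a particular solution, and the substitution `x = 2 κᵢ D / σ²` turns the homogeneous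
equation into Kummer's equation `x y'' + (b - x) y' - a y = 0`. It is solved by `M(a, b, ·)`, as
comparison of coefficients shows (`kummerM_ode`), and by `U(a, b, ·)`, because the three terms of
the equation combine to the integral of an exact derivative (`tricomiIntegral_ode`). Here `M` is
regular at `0` and `U` vanishes at infinity, which gives `Phi` its behaviour at both ends.

The constants `E` and `F` solve the linear system that makes the two branches of `Phi` meet at the
threshold with equal values and equal first derivatives (`E_mul_sub_F_mul`). The second derivatives
then agree too, since the two drifts coincide there and each branch solves its equation; hence `Phi`
is `C²`. The sign of `E` is read off its formula, and that of `F` follows from the convexity of `m`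
(`F_pos`).

Uniqueness is a maximum principle, and needs no description of the other solutions of Kummer's
equation. The function `D² - log D + C` is a supersolution of the homogeneous equation for large `C`
(`exists_barrier`). The conditions `2 κᵢ θᵢ / σ² ≥ 1` are exactly what bounds the contribution of
`-log D` at the origin. It tends to infinity at `0`, and faster than linearly at infinity, so it
dominates the difference of two solutions at both ends. Subtracting a small multiple of it from this
difference leaves a function without a positive maximum (`solution_le`).
-/

noncomputable section

/-! ### Kummer's function of the first kind -/

/-- The `n`-th coefficient `(a)ₙ / ((b)ₙ n!)` of the power series of `kummerM a b`. -/
def kummerCoeff (a b : ℝ) (n : ℕ) : ℝ :=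
  (ascPochhammer ℝ n).eval a / (ascPochhammer ℝ n).eval b / (n.factorial : ℝ)

theorem kummerM_eq_tsum (a b x : ℝ) : kummerM a b x = ∑' n, kummerCoeff a b n * x ^ n := by
  unfold kummerM kummerCoeff
  exact tsum_congr fun n => by ring

theorem kummerCoeff_zero (a b : ℝ) : kummerCoeff a b 0 = 1 := by
  simp [kummerCoeff]

theorem kummerCoeff_pos {a b : ℝ} (ha : 0 < a) (hb : 0 < b) (n : ℕ) : 0 < kummerCoeff a b n :=
  div_pos (div_pos (ascPochhammer_pos n a ha) (ascPochhammer_pos n b hb))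
    (by exact_mod_cast n.factorial_pos)

/-- The two-term recurrence of the coefficients, which encodes Kummer's equation. -/
theorem kummerCoeff_succ {b : ℝ} (a : ℝ) (hb : 0 < b) (n : ℕ) :
    (n + 1) * (b + n) * kummerCoeff a b (n + 1) = (a + n) * kummerCoeff a b n := by
  have h1 := (ascPochhammer_pos n b hb).ne'
  have h2 : (n.factorial : ℝ) ≠ 0 := by exact_mod_cast n.factorial_ne_zero
  have h3 : b + n ≠ 0 := by positivity
  have h4 : (n : ℝ) + 1 ≠ 0 := by positivity
  simp only [kummerCoeff, ascPochhammer_succ_eval, Nat.factorial_succ]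
  push_cast
  field_simp

theorem ascPochhammer_eval_succ_left (a : ℝ) (n : ℕ) :
    (ascPochhammer ℝ (n + 1)).eval a = a * (ascPochhammer ℝ n).eval (a + 1) := by
  simp [ascPochhammer_succ_left, Polynomial.eval_comp]

theorem succ_mul_kummerCoeff_succ {b : ℝ} (a : ℝ) (hb : 0 < b) (n : ℕ) :
    (n + 1) * kummerCoeff a b (n + 1) = a / b * kummerCoeff (a + 1) (b + 1) n := by
  have h1 := (ascPochhammer_pos n (b + 1) (by positivity)).ne'
  have h2 : (n.factorial : ℝ) ≠ 0 := by exact_mod_cast n.factorial_ne_zero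
  have h4 : (n : ℝ) + 1 ≠ 0 := by positivity
  simp only [kummerCoeff, ascPochhammer_eval_succ_left, Nat.factorial_succ]
  push_cast
  field_simp

/-- The coefficients are dominated by those of an exponential series, because the ratio
`(a + n) / (b + n)` never exceeds `max 1 (a / b)`. -/
theorem kummerCoeff_le {a b : ℝ} (ha : 0 < a) (hb : 0 < b) (n : ℕ) :
    kummerCoeff a b n ≤ max 1 (a / b) ^ n / n.factorial := by
  induction n with
  | zero => simp [kummerCoeff_zero]
  | succ n ih =>
    have h1 : (a + n) ≤ max 1 (a / b) * (b + n) := by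
      have e1 : a ≤ max 1 (a / b) * b := by
        calc a = a / b * b := by field_simp
          _ ≤ _ := by gcongr; exact le_max_right _ _
      have e2 : (n : ℝ) ≤ max 1 (a / b) * n :=
        le_mul_of_one_le_left (by positivity) (le_max_left _ _)
      linarith
    have h2 := kummerCoeff_succ a hb n
    have hc := kummerCoeff_pos ha hb n
    have hbn : 0 < b + n := by positivity
    have h3 : (n + 1) * kummerCoeff a b (n + 1) ≤ max 1 (a / b) * kummerCoeff a b n := by
      refine le_of_mul_le_mul_left ?_ hbn
      nlinarith
    have h4 : (n + 1) * kummerCoeff a b (n + 1) ≤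
        max 1 (a / b) * (max 1 (a / b) ^ n / n.factorial) :=
      h3.trans (by gcongr)
    rw [Nat.factorial_succ]
    push_cast
    rw [le_div_iff₀ (by positivity)]
    have h5 : (0 : ℝ) < n.factorial := by positivity
    calc kummerCoeff a b (n + 1) * ((n + 1) * n.factorial)
        = (n + 1) * kummerCoeff a b (n + 1) * n.factorial := by ring
      _ ≤ max 1 (a / b) * (max 1 (a / b) ^ n / n.factorial) * n.factorial := by gcongr
      _ = max 1 (a / b) ^ (n + 1) := by field_simp; ring

theorem summable_kummer {a b : ℝ} (ha : 0 < a) (hb : 0 < b) (x : ℝ) :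
    Summable fun n => kummerCoeff a b n * x ^ n := by
  refine Summable.of_norm_bounded (Real.summable_pow_div_factorial (max 1 (a / b) * |x|))
    fun n => ?_
  rw [norm_mul, norm_pow, Real.norm_eq_abs, Real.norm_eq_abs,
    abs_of_pos (kummerCoeff_pos ha hb n), mul_pow, mul_div_right_comm]
  gcongr
  exact kummerCoeff_le ha hb n

theorem hasSum_kummerM {a b : ℝ} (ha : 0 < a) (hb : 0 < b) (x : ℝ) :
    HasSum (fun n => kummerCoeff a b n * x ^ n) (kummerM a b x) := by
  rw [kummerM_eq_tsum]
  exact (summable_kummer ha hb x).hasSum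

theorem kummerM_pos {a b x : ℝ} (ha : 0 < a) (hb : 0 < b) (hx : 0 ≤ x) : 0 < kummerM a b x := by
  rw [kummerM_eq_tsum]
  refine (summable_kummer ha hb x).tsum_pos
    (fun n => mul_nonneg (kummerCoeff_pos ha hb n).le (pow_nonneg hx n)) 0 ?_
  simp [kummerCoeff_zero]

/-- The termwise derivative of the series of `kummerM a b`. -/
theorem hasSum_deriv_kummerM {a b : ℝ} (ha : 0 < a) (hb : 0 < b) (x : ℝ) :
    HasSum (fun n : ℕ => kummerCoeff a b n * (n * x ^ (n - 1)))
      (a / b * kummerM (a + 1) (b + 1) x) := by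
  have h := (hasSum_kummerM (a := a + 1) (b := b + 1) (by positivity) (by positivity) x).mul_left
    (a / b)
  rw [← hasSum_nat_add_iff' 1]
  simp only [Finset.range_one, Finset.sum_singleton, Nat.cast_zero, zero_mul, mul_zero, sub_zero]
  refine h.congr_fun fun n => ?_
  have e := succ_mul_kummerCoeff_succ a hb n
  push_cast
  linear_combination x ^ n * e

theorem hasDerivAt_kummerM {a b : ℝ} (ha : 0 < a) (hb : 0 < b) (x : ℝ) :
    HasDerivAt (kummerM a b) (a / b * kummerM (a + 1) (b + 1) x) x := by
  -- The derivative of the `n`-th term is dominated on the ball of radius `R` by its value at `R`.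
  set R := |x| + 1
  have hR : 0 ≤ R := by positivity
  have hx : x ∈ Metric.ball (0 : ℝ) R := by simp [R]
  have key := hasDerivAt_tsum_of_isPreconnected
    (hasSum_deriv_kummerM ha hb R).summable Metric.isOpen_ball
    (convex_ball (0 : ℝ) R).isPreconnected
    (g := fun n y => kummerCoeff a b n * y ^ n)
    (g' := fun n y => kummerCoeff a b n * (n * y ^ (n - 1)))
    (fun n y _ => (hasDerivAt_pow n y).const_mul _) (fun n y hy => ?_) hx
    (summable_kummer ha hb x) hx
  · rw [(hasSum_deriv_kummerM ha hb x).tsum_eq] at key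
    exact key.congr_of_eventuallyEq (.of_forall fun y => kummerM_eq_tsum a b y)
  · have hy' : |y| ≤ R := by simpa using (mem_ball_zero_iff.1 hy).le
    rw [norm_mul, norm_mul, norm_pow, Real.norm_eq_abs, Real.norm_eq_abs, Real.norm_eq_abs,
      abs_of_pos (kummerCoeff_pos ha hb n), Nat.abs_cast]
    have := (kummerCoeff_pos ha hb n).le
    gcongr

/-- Kummer's equation `x y'' + (b - x) y' - a y = 0` for `y = M(a, b, ·)`, with the derivatives
expressed by contiguous functions. -/
theorem kummerM_ode {a b : ℝ} (ha : 0 < a) (hb : 0 < b) (x : ℝ) :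
    x * (a / b * ((a + 1) / (b + 1) * kummerM (a + 1 + 1) (b + 1 + 1) x))
      + (b - x) * (a / b * kummerM (a + 1) (b + 1) x) - a * kummerM a b x = 0 := by
  have h0 := (hasSum_kummerM ha hb x).mul_left a
  have h1 := (hasSum_kummerM (a := a + 1) (b := b + 1) (by positivity) (by positivity) x).mul_left
    (b * (a / b))
  have h2 := (hasSum_deriv_kummerM ha hb x).mul_left x
  have h3 := (hasSum_deriv_kummerM (a := a + 1) (b := b + 1) (by positivity) (by positivity)
    x).mul_left (x * (a / b))
  have h := ((h3.add h1).sub h2).sub h0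
  have hz : HasSum (fun _ : ℕ => (0 : ℝ)) 0 := hasSum_zero
  have := hz.unique (h.congr_fun fun n => ?_)
  · linear_combination -this
  · have hx : x * (n * x ^ (n - 1)) = n * x ^ n := by
      rcases n with _ | n
      · simp
      · simp only [Nat.add_sub_cancel]; ring
    have e1 := succ_mul_kummerCoeff_succ a hb n
    have e2 := kummerCoeff_succ a hb n
    linear_combination (a / b * kummerCoeff (a + 1) (b + 1) n) * (-hx) +
      kummerCoeff a b n * hx + (n + b) * x ^ n * e1 - x ^ n * e2

/-! ### Tricomi's function -/

/-- Any power of `1 + t` is absorbed by an arbitrarily slow exponential, whatever the sign of the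
exponent. -/
theorem one_add_rpow_le_exp (c : ℝ) {δ : ℝ} (hδ : 0 < δ) :
    ∃ C : ℝ, 0 < C ∧ ∀ t : ℝ, 0 ≤ t → (1 + t) ^ c ≤ C * Real.exp (δ * t) := by
  set k := |c| + 1
  have hk : 0 < k := by positivity
  refine ⟨(k / δ) ^ k * Real.exp δ, by positivity, fun t ht => ?_⟩
  have h1 : (1 : ℝ) ≤ 1 + t := by linarith
  have h2 : δ / k * (1 + t) ≤ Real.exp (δ / k * (1 + t)) := by
    linarith [Real.add_one_le_exp (δ / k * (1 + t))]
  calc (1 + t) ^ c ≤ (1 + t) ^ k :=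
        Real.rpow_le_rpow_of_exponent_le h1 ((le_abs_self c).trans (by simp [k]))
    _ = (k / δ * (δ / k * (1 + t))) ^ k := by congr 1; field_simp
    _ ≤ (k / δ * Real.exp (δ / k * (1 + t))) ^ k := by gcongr
    _ = (k / δ) ^ k * Real.exp (δ / k * (1 + t) * k) := by
        rw [Real.mul_rpow (by positivity) (by positivity), ← Real.exp_mul]
    _ = (k / δ) ^ k * Real.exp δ * Real.exp (δ * t) := by
        rw [mul_assoc ((k / δ) ^ k), ← Real.exp_add]
        congr 2
        field_simp

/-- The integrand of the Laplace transform of `t ^ s * (1 + t) ^ c`. -/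
def tricomiKernel (s c x t : ℝ) : ℝ := Real.exp (-(x * t)) * t ^ s * (1 + t) ^ c

theorem tricomiKernel_pos (s c x : ℝ) {t : ℝ} (ht : 0 < t) : 0 < tricomiKernel s c x t := by
  unfold tricomiKernel; positivity

theorem continuousOn_tricomiKernel (s c x : ℝ) : ContinuousOn (tricomiKernel s c x) (Ioi 0) := by
  refine ContinuousOn.mul (ContinuousOn.mul (by fun_prop) ?_) ?_
  · exact continuousOn_id.rpow_const fun t ht => Or.inl (ne_of_gt ht)
  · refine ContinuousOn.rpow_const (by fun_prop) fun t ht => Or.inl ?_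
    have : (0 : ℝ) < t := ht
    positivity

theorem aestronglyMeasurable_tricomiKernel (s c x : ℝ) :
    AEStronglyMeasurable (tricomiKernel s c x) (volume.restrict (Ioi 0)) :=
  (continuousOn_tricomiKernel s c x).aestronglyMeasurable measurableSet_Ioi

theorem exists_tricomiKernel_le (s c : ℝ) {x : ℝ} (hx : 0 < x) :
    ∃ C : ℝ, 0 < C ∧ ∀ t, 0 ≤ t →
      tricomiKernel s c x t ≤ C * (t ^ s * Real.exp (-(x / 2) * t)) := by
  obtain ⟨C, hC, h⟩ := one_add_rpow_le_exp c (half_pos hx)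
  refine ⟨C, hC, fun t ht => ?_⟩
  calc tricomiKernel s c x t ≤ Real.exp (-(x * t)) * t ^ s * (C * Real.exp (x / 2 * t)) := by
        unfold tricomiKernel; gcongr; exact h t ht
    _ = C * (t ^ s * (Real.exp (-(x * t)) * Real.exp (x / 2 * t))) := by ring
    _ = _ := by rw [← Real.exp_add]; congr 3; ring

theorem integrableOn_tricomiKernel {s x : ℝ} (hs : -1 < s) (c : ℝ) (hx : 0 < x) :
    IntegrableOn (tricomiKernel s c x) (Ioi 0) := by
  obtain ⟨C, -, h⟩ := exists_tricomiKernel_le s c hx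
  have hi := (integrableOn_rpow_mul_exp_neg_mul_rpow hs one_pos (half_pos hx)).const_mul C
  refine Integrable.mono' hi (aestronglyMeasurable_tricomiKernel s c x) ?_
  filter_upwards [ae_restrict_mem measurableSet_Ioi] with t ht
  rw [Real.norm_of_nonneg (tricomiKernel_pos s c x ht).le, Real.rpow_one]
  exact h t (le_of_lt ht)

theorem tendsto_tricomiKernel_atTop (s c : ℝ) {x : ℝ} (hx : 0 < x) :
    Tendsto (tricomiKernel s c x) atTop (𝓝 0) := by
  obtain ⟨C, -, h⟩ := exists_tricomiKernel_le s c hx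
  have hl := (tendsto_rpow_mul_exp_neg_mul_atTop_nhds_zero s (x / 2) (half_pos hx)).const_mul C
  rw [mul_zero] at hl
  refine squeeze_zero' ?_ ?_ hl
  · filter_upwards [eventually_gt_atTop 0] with t ht using (tricomiKernel_pos s c x ht).le
  · filter_upwards [eventually_ge_atTop 0] with t ht using h t ht

theorem tricomiKernel_add_one (s c x : ℝ) {t : ℝ} (ht : 0 < t) :
    tricomiKernel (s + 1) c x t = t * tricomiKernel s c x t := by
  unfold tricomiKernel
  rw [Real.rpow_add_one ht.ne']
  ring

/-- The Laplace transform of `t ^ s * (1 + t) ^ c`, the integral in Tricomi's function. -/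
def tricomiIntegral (s c x : ℝ) : ℝ := ∫ t in Ioi (0 : ℝ), tricomiKernel s c x t

theorem tricomiIntegral_pos {s x : ℝ} (hs : -1 < s) (c : ℝ) (hx : 0 < x) :
    0 < tricomiIntegral s c x := by
  refine (setIntegral_pos_iff_support_of_nonneg_ae ?_ (integrableOn_tricomiKernel hs c hx)).2 ?_
  · filter_upwards [ae_restrict_mem measurableSet_Ioi] with t ht
    exact (tricomiKernel_pos s c x ht).le
  · have : Ioi 0 ⊆ Function.support (tricomiKernel s c x) :=
      fun t ht => (tricomiKernel_pos s c x ht).ne'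
    rw [inter_eq_self_of_subset_right this]
    simp

theorem hasDerivAt_tricomiIntegral {s x : ℝ} (hs : -1 < s) (c : ℝ) (hx : 0 < x) :
    HasDerivAt (tricomiIntegral s c) (-tricomiIntegral (s + 1) c x) x := by
  -- On `(x / 2, ∞)` the derivatives of the integrand are dominated by the one at `x / 2`.
  have h := (hasDerivAt_integral_of_dominated_loc_of_deriv_le
    (μ := volume.restrict (Ioi (0 : ℝ))) (F := fun y t => tricomiKernel s c y t)
    (F' := fun y t => -tricomiKernel (s + 1) c y t) (x₀ := x)
    (bound := tricomiKernel (s + 1) c (x / 2)) (Ioi_mem_nhds (half_lt_self hx))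
    (.of_forall fun y => aestronglyMeasurable_tricomiKernel s c y)
    (integrableOn_tricomiKernel hs c hx) (aestronglyMeasurable_tricomiKernel (s + 1) c x).neg
    ?_ (integrableOn_tricomiKernel (by linarith) c (half_pos hx)) ?_).2
  · rwa [integral_neg] at h
  · filter_upwards [ae_restrict_mem measurableSet_Ioi] with t ht y hy
    have ht' : (0 : ℝ) < t := ht
    have hy' : x / 2 < y := hy
    rw [norm_neg, Real.norm_of_nonneg (tricomiKernel_pos _ c y ht).le]
    unfold tricomiKernel
    gcongr
  · filter_upwards [ae_restrict_mem measurableSet_Ioi] with t ht y _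
    have ht' : (0 : ℝ) < t := ht
    rw [tricomiKernel_add_one s c y ht']
    unfold tricomiKernel
    have h1 : HasDerivAt (fun y : ℝ => Real.exp (-(y * t))) (Real.exp (-(y * t)) * -(1 * t)) y :=
      ((hasDerivAt_id y).mul_const t).neg.exp
    exact ((h1.mul_const (t ^ s)).mul_const ((1 + t) ^ c)).congr_deriv (by ring)

theorem tendsto_tricomiIntegral_atTop {s : ℝ} (hs : -1 < s) (c : ℝ) :
    Tendsto (tricomiIntegral s c) atTop (𝓝 0) := by
  have h := tendsto_integral_filter_of_dominated_convergence (μ := volume.restrict (Ioi (0 : ℝ)))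
    (F := fun y t => tricomiKernel s c y t) (f := fun _ => 0) (l := atTop) (tricomiKernel s c 1)
    (.of_forall fun y => aestronglyMeasurable_tricomiKernel s c y) ?_
    (integrableOn_tricomiKernel hs c one_pos) ?_
  · rwa [integral_zero] at h
  · filter_upwards [eventually_ge_atTop 1] with y hy
    filter_upwards [ae_restrict_mem measurableSet_Ioi] with t ht
    have ht' : (0 : ℝ) < t := ht
    rw [Real.norm_of_nonneg (tricomiKernel_pos _ c y ht).le]
    unfold tricomiKernel
    gcongr
  · filter_upwards [ae_restrict_mem measurableSet_Ioi] with t ht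
    have h1 : Tendsto (fun y : ℝ => Real.exp (-(y * t))) atTop (𝓝 0) :=
      Real.tendsto_exp_neg_atTop_nhds_zero.comp (tendsto_id.atTop_mul_const ht)
    simpa [tricomiKernel] using (h1.mul_const (t ^ s)).mul_const ((1 + t) ^ c)

/-- Kummer's equation in integral form: the three integrands add up to the derivative of
`-exp (-x t) t ^ a (1 + t) ^ (c + 1)`, which vanishes at both ends of `(0, ∞)`. -/
theorem tricomiIntegral_ode {a x : ℝ} (ha : 0 < a) (c : ℝ) (hx : 0 < x) :
    x * tricomiIntegral (a + 1) c x - (a + c + 1 - x) * tricomiIntegral a c x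
      - a * tricomiIntegral (a - 1) c x = 0 := by
  have i0 := (integrableOn_tricomiKernel (s := a - 1) (by linarith) c hx).const_mul a
  have i1 := (integrableOn_tricomiKernel (s := a) (by linarith) c hx).const_mul (a + c + 1 - x)
  have i2 := (integrableOn_tricomiKernel (s := a + 1) (by linarith) c hx).const_mul x
  have h := integral_Ioi_of_hasDerivAt_of_tendsto (a := (0 : ℝ)) (m := 0)
    (f := fun t => -tricomiKernel a (c + 1) x t)
    (f' := fun t => x * tricomiKernel (a + 1) c x t - (a + c + 1 - x) * tricomiKernel a c x t
      - a * tricomiKernel (a - 1) c x t) ?_ ?_ ((i2.sub i1).sub i0) ?_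
  · have e := integral_sub (i2.sub i1) i0
    simp only [Pi.sub_apply] at e
    rw [e, integral_sub i2 i1, integral_const_mul, integral_const_mul, integral_const_mul] at h
    simpa [tricomiIntegral, tricomiKernel, Real.zero_rpow ha.ne'] using h
  · have : ContinuousAt (fun t => -tricomiKernel a (c + 1) x t) 0 := by
      unfold tricomiKernel
      refine ContinuousAt.neg (ContinuousAt.mul (ContinuousAt.mul (by fun_prop) ?_) ?_)
      · exact continuousAt_id.rpow_const (Or.inr ha.le)
      · exact ContinuousAt.rpow_const (by fun_prop) (Or.inl (by norm_num))
    exact this.continuousWithinAt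
  · intro t ht
    have ht' : (0 : ℝ) < t := ht
    have e1 : HasDerivAt (fun y : ℝ => Real.exp (-(x * y))) (Real.exp (-(x * t)) * -(x * 1)) t :=
      ((hasDerivAt_id t).const_mul x).neg.exp
    have e2 : HasDerivAt (fun y : ℝ => y ^ a) (a * t ^ (a - 1)) t :=
      Real.hasDerivAt_rpow_const (Or.inl ht'.ne')
    have e3 : HasDerivAt (fun y : ℝ => (1 + y) ^ (c + 1)) (1 * (c + 1) * (1 + t) ^ (c + 1 - 1)) t :=
      ((hasDerivAt_id t).const_add 1).rpow_const (Or.inl (by simp; positivity))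
    refine ((e1.mul e2).mul e3).neg.congr_deriv ?_
    have f1 : t ^ (a + 1) = t ^ (a - 1) * t * t := by
      rw [← Real.rpow_add_one ht'.ne', ← Real.rpow_add_one ht'.ne']; congr 1; ring
    have f2 : t ^ a = t ^ (a - 1) * t := by
      rw [← Real.rpow_add_one ht'.ne']; congr 1; ring
    have f3 : (1 + t) ^ (c + 1) = (1 + t) ^ c * (1 + t) := Real.rpow_add_one (by positivity) c
    simp only [tricomiKernel, f1, f3, add_sub_cancel_right, Pi.mul_apply]
    rw [f2]
    ring
  · simpa using (tendsto_tricomiKernel_atTop a (c + 1) hx).neg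

theorem tricomiU_eq (a b x : ℝ) :
    tricomiU a b x = (Real.Gamma a)⁻¹ * tricomiIntegral (a - 1) (b - a - 1) x := rfl

theorem tricomiU_add_one {a : ℝ} (ha : 0 < a) (b x : ℝ) :
    a * tricomiU (a + 1) (b + 1) x = (Real.Gamma a)⁻¹ * tricomiIntegral a (b - a - 1) x := by
  have h := (Real.Gamma_pos_of_pos ha).ne'
  rw [tricomiU_eq, Real.Gamma_add_one ha.ne', show a + 1 - 1 = a by ring,
    show b + 1 - (a + 1) - 1 = b - a - 1 by ring]
  field_simp

theorem tricomiU_pos {a x : ℝ} (ha : 0 < a) (b : ℝ) (hx : 0 < x) : 0 < tricomiU a b x :=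
  mul_pos (inv_pos.2 (Real.Gamma_pos_of_pos ha)) (tricomiIntegral_pos (by linarith) _ hx)

theorem hasDerivAt_tricomiU {a x : ℝ} (ha : 0 < a) (b : ℝ) (hx : 0 < x) :
    HasDerivAt (tricomiU a b) (-(a * tricomiU (a + 1) (b + 1) x)) x := by
  have h := (hasDerivAt_tricomiIntegral (s := a - 1) (by linarith) (b - a - 1) hx).const_mul
    (Real.Gamma a)⁻¹
  refine h.congr_deriv ?_
  rw [tricomiU_add_one ha, sub_add_cancel]
  ring

theorem tendsto_tricomiU_atTop {a : ℝ} (ha : 0 < a) (b : ℝ) :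
    Tendsto (tricomiU a b) atTop (𝓝 0) := by
  have h := (tendsto_tricomiIntegral_atTop (s := a - 1) (by linarith) (b - a - 1)).const_mul
    (Real.Gamma a)⁻¹
  rwa [mul_zero] at h

/-- Kummer's equation `x y'' + (b - x) y' - a y = 0` for `y = U(a, b, ·)`, with the derivatives
expressed by contiguous functions. -/
theorem tricomiU_ode {a x : ℝ} (ha : 0 < a) (b : ℝ) (hx : 0 < x) :
    x * (a * ((a + 1) * tricomiU (a + 1 + 1) (b + 1 + 1) x))
      - (b - x) * (a * tricomiU (a + 1) (b + 1) x) - a * tricomiU a b x = 0 := by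
  have h := tricomiIntegral_ode ha (b - a - 1) hx
  have e2 : a * ((a + 1) * tricomiU (a + 1 + 1) (b + 1 + 1) x) =
      (Real.Gamma a)⁻¹ * tricomiIntegral (a + 1) (b - a - 1) x := by
    have hg := (Real.Gamma_pos_of_pos ha).ne'
    rw [tricomiU_add_one (a := a + 1) (by linarith), Real.Gamma_add_one ha.ne',
      show b + 1 - (a + 1) - 1 = b - a - 1 by ring]
    field_simp
  rw [e2, tricomiU_add_one ha, tricomiU_eq]
  linear_combination (Real.Gamma a)⁻¹ * h

/-! ### Gluing and second derivatives -/

/-- Two functions that agree to first order at `c` can be glued there differentiably. -/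
theorem HasDerivAt.ite_le {f g f' g' : ℝ → ℝ} {c x : ℝ} (hf : HasDerivAt f (f' x) x)
    (hg : HasDerivAt g (g' x) x) (h : f c = g c) (h' : f' c = g' c) :
    HasDerivAt (fun y => if y ≤ c then f y else g y) (if x ≤ c then f' x else g' x) x := by
  rcases lt_trichotomy x c with hx | rfl | hx
  · rw [if_pos hx.le]
    refine hf.congr_of_eventuallyEq ?_
    filter_upwards [Iio_mem_nhds hx] with y hy using if_pos (le_of_lt hy)
  · rw [if_pos le_rfl]
    have h1 : HasDerivWithinAt (fun y => if y ≤ x then f y else g y) (f' x) (Iic x) x :=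
      hf.hasDerivWithinAt.congr (fun y hy => if_pos hy) (if_pos le_rfl)
    have h2 : HasDerivWithinAt (fun y => if y ≤ x then f y else g y) (f' x) (Ici x) x := by
      rw [h']
      refine hg.hasDerivWithinAt.congr (fun y hy => ?_) (by rw [if_pos le_rfl, h])
      rcases (show x ≤ y from hy).eq_or_lt with rfl | hy'
      · rw [if_pos le_rfl, h]
      · exact if_neg hy'.not_ge
    simpa [Iic_union_Ici, hasDerivWithinAt_univ] using h1.union h2
  · rw [if_neg hx.not_ge]
    refine hg.congr_of_eventuallyEq ?_
    filter_upwards [Ioi_mem_nhds hx] with y hy using if_neg (not_le_of_gt hy)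

theorem deriv_deriv_eq_of_hasDerivAt {s : Set ℝ} (hs : IsOpen s) {f f' f'' : ℝ → ℝ}
    (h1 : ∀ x ∈ s, HasDerivAt f (f' x) x) (h2 : ∀ x ∈ s, HasDerivAt f' (f'' x) x) {x : ℝ}
    (hx : x ∈ s) : deriv (deriv f) x = f'' x := by
  have : deriv f =ᶠ[𝓝 x] f' := by
    filter_upwards [hs.mem_nhds hx] with y hy using (h1 y hy).deriv
  rw [this.deriv_eq, (h2 x hx).deriv]

theorem contDiffOn_two_of_hasDerivAt {s : Set ℝ} (hs : IsOpen s) {f f' f'' : ℝ → ℝ}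
    (h1 : ∀ x ∈ s, HasDerivAt f (f' x) x) (h2 : ∀ x ∈ s, HasDerivAt f' (f'' x) x)
    (hc : ContinuousOn f'' s) : ContDiffOn ℝ 2 f s := by
  have e1 : EqOn (deriv f) f' s := fun x hx => (h1 x hx).deriv
  have e2 : EqOn (deriv f') f'' s := fun x hx => (h2 x hx).deriv
  rw [show (2 : WithTop ℕ∞) = 1 + 1 by norm_num, contDiffOn_succ_iff_deriv_of_isOpen hs]
  refine ⟨fun x hx => (h1 x hx).differentiableAt.differentiableWithinAt, by simp, ?_⟩
  refine ContDiffOn.congr ?_ e1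
  rw [show (1 : WithTop ℕ∞) = 0 + 1 by norm_num, contDiffOn_succ_iff_deriv_of_isOpen hs]
  refine ⟨fun x hx => (h2 x hx).differentiableAt.differentiableWithinAt, by simp, ?_⟩
  rw [contDiffOn_zero]
  exact hc.congr e2

theorem ContDiffOn.hasDerivAt_deriv {s : Set ℝ} (hs : IsOpen s) {f : ℝ → ℝ}
    (hf : ContDiffOn ℝ 2 f s) {x : ℝ} (hx : x ∈ s) :
    HasDerivAt f (deriv f x) x ∧ HasDerivAt (deriv f) (deriv (deriv f) x) x := by
  have h1 : ContDiffOn ℝ 1 (deriv f) s := by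
    rw [show (2 : WithTop ℕ∞) = 1 + 1 by norm_num, contDiffOn_succ_iff_deriv_of_isOpen hs] at hf
    exact hf.2.2
  exact ⟨((hf.differentiableOn (by norm_num)).differentiableAt (hs.mem_nhds hx)).hasDerivAt,
    ((h1.differentiableOn (by norm_num)).differentiableAt (hs.mem_nhds hx)).hasDerivAt⟩

/-! ### The maximum principle and comparison of solutions -/

/-- Weak maximum principle on `(0, ∞)`: a function that is nonpositive near both ends and that is
strictly convex (to second order) at each critical point with a positive value is nonpositive. -/
theorem nonpos_of_deriv_deriv_pos {g : ℝ → ℝ} (hc : ContinuousOn g (Ioi 0))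
    (h0 : ∀ᶠ x in 𝓝[>] (0 : ℝ), g x ≤ 0) (hi : ∀ᶠ x in atTop, g x ≤ 0)
    (h : ∀ x, 0 < x → 0 < g x → deriv g x = 0 → 0 < deriv (deriv g) x) {x : ℝ} (hx : 0 < x) :
    g x ≤ 0 := by
  by_contra! hgx
  obtain ⟨δ, hδ, hδ0, hδx⟩ : ∃ δ, g δ ≤ 0 ∧ 0 < δ ∧ δ < x := by
    have := h0.and (Ioo_mem_nhdsGT hx)
    obtain ⟨δ, h1, h2⟩ := this.exists
    exact ⟨δ, h1, h2.1, h2.2⟩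
  obtain ⟨R, hR, hxR⟩ := (hi.and (eventually_gt_atTop x)).exists
  have hsub : Icc δ R ⊆ Ioi 0 := fun y hy => hδ0.trans_le hy.1
  obtain ⟨y, hy, hmax⟩ := isCompact_Icc.exists_isMaxOn ⟨x, hδx.le, hxR.le⟩ (hc.mono hsub)
  have hgy : 0 < g y := hgx.trans_le (hmax ⟨hδx.le, hxR.le⟩)
  have hy1 : δ < y := hy.1.lt_of_ne (by rintro rfl; linarith)
  have hy2 : y < R := hy.2.lt_of_ne (by rintro rfl; linarith)
  have hlmax : IsLocalMax g y := hmax.isLocalMax (Icc_mem_nhds hy1 hy2)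
  have hpos := h y (hsub hy) hgy hlmax.deriv_eq_zero
  -- The second derivative test makes `y` a local minimum too, so that `g` is constant near `y`.
  have hlmin : IsLocalMin g y := isLocalMin_of_deriv_deriv_pos hpos hlmax.deriv_eq_zero
    (hc.continuousAt (isOpen_Ioi.mem_nhds (hsub hy)))
  have hconst : g =ᶠ[𝓝 y] fun _ => g y := by
    filter_upwards [hlmax, hlmin] with z h1 h2 using le_antisymm h1 h2
  have : deriv (deriv g) y = 0 := by rw [hconst.deriv.deriv_eq]; simp
  linarith

namespace DividendModel

/-- The standing assumptions on the parameters. The bounds on `2 κᵢ θᵢ / σ²` (Feller's condition)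
are stated without division. -/
structure Admissible (p : DividendModel) : Prop where
  κ₂_pos : 0 < p.κ₂
  κ_lt : p.κ₂ < p.κ₁
  θ₁_pos : 0 < p.θ₁
  θ_le : p.θ₁ ≤ p.θ₂
  κθ_lt : p.κ₂ * p.θ₂ < p.κ₁ * p.θ₁
  σ_pos : 0 < p.σ
  lam_pos : 0 < p.lam
  feller₁ : p.σ ^ 2 ≤ 2 * p.κ₁ * p.θ₁
  feller₂ : p.σ ^ 2 ≤ 2 * p.κ₂ * p.θ₂

/-- The larger of the two drifts, the coefficient of the first derivative in the equation. -/
def drift (p : DividendModel) (D : ℝ) : ℝ := max (p.κ₁ * (p.θ₁ - D)) (p.κ₂ * (p.θ₂ - D))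

namespace Admissible

variable {p : DividendModel}

/-- For a suitable constant `C`, the function `D² - log D + C` is a supersolution of the homogeneous
equation. Feller's condition is what makes the contribution of `-log D` bounded above at `0`. -/
theorem exists_barrier (hp : p.Admissible) : ∃ C : ℝ, 0 ≤ C ∧ ∀ D, 0 < D →
    p.drift D * (2 * D - 1 / D) + 1 / 2 * p.σ ^ 2 * D * (2 + 1 / D ^ 2)
      - p.lam * (D ^ 2 - Real.log D + C) ≤ 0 := by
  obtain ⟨hκ₂, hκ, hθ₁, -, hκθ, -, hlam, hf₁, hf₂⟩ := hp
  have hκ₁ : 0 < p.κ₁ := hκ₂.trans hκ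
  set q := 2 * p.κ₁ * p.θ₁ + p.σ ^ 2 + p.lam
  refine ⟨(p.κ₁ + q ^ 2 / (4 * p.lam)) / p.lam, by positivity, fun D hD => ?_⟩
  have hsq : q * D - p.lam * D ^ 2 ≤ q ^ 2 / (4 * p.lam) := by
    rw [le_div_iff₀ (by positivity)]
    nlinarith [sq_nonneg (q - 2 * p.lam * D)]
  have hC : p.lam * ((p.κ₁ + q ^ 2 / (4 * p.lam)) / p.lam) = p.κ₁ + q ^ 2 / (4 * p.lam) := by
    field_simp
  have hlog : p.lam * Real.log D ≤ p.lam * D := by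
    gcongr
    linarith [Real.log_le_sub_one_of_pos hD]
  have key : ∀ κ θ : ℝ, 0 < κ → κ ≤ p.κ₁ → κ * θ ≤ p.κ₁ * p.θ₁ → p.σ ^ 2 ≤ 2 * κ * θ →
      κ * (θ - D) * (2 * D - 1 / D) + 1 / 2 * p.σ ^ 2 * D * (2 + 1 / D ^ 2) ≤
        (2 * p.κ₁ * p.θ₁ + p.σ ^ 2) * D + p.κ₁ := by
    intro κ θ h1 h2 h3 h4
    -- Feller's condition `h4` makes the coefficient of `-1 / (2 * D)` nonnegative.
    have e : κ * (θ - D) * (2 * D - 1 / D) + 1 / 2 * p.σ ^ 2 * D * (2 + 1 / D ^ 2) =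
        (2 * (κ * θ) + p.σ ^ 2) * D + κ - 2 * κ * D ^ 2 - (2 * κ * θ - p.σ ^ 2) / (2 * D) := by
      field_simp
      ring
    have h5 : 0 ≤ (2 * κ * θ - p.σ ^ 2) / (2 * D) := div_nonneg (by linarith) (by positivity)
    have h6 : 0 ≤ 2 * κ * D ^ 2 := by positivity
    have h7 : (2 * (κ * θ) + p.σ ^ 2) * D ≤ (2 * p.κ₁ * p.θ₁ + p.σ ^ 2) * D :=
      mul_le_mul_of_nonneg_right (by linarith) hD.le
    linarith
  have hdrift : p.drift D * (2 * D - 1 / D) + 1 / 2 * p.σ ^ 2 * D * (2 + 1 / D ^ 2) ≤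
      (2 * p.κ₁ * p.θ₁ + p.σ ^ 2) * D + p.κ₁ := by
    unfold drift
    rcases max_choice (p.κ₁ * (p.θ₁ - D)) (p.κ₂ * (p.θ₂ - D)) with h | h <;> rw [h]
    · exact key _ _ hκ₁ le_rfl le_rfl hf₁
    · exact key _ _ hκ₂ hκ.le hκθ.le hf₂
  have hq : q * D = (2 * p.κ₁ * p.θ₁ + p.σ ^ 2) * D + p.lam * D := by ring
  linarith

/-- Comparison of solutions: `φ - ψ - ε (D² - log D + C)` satisfies the maximum principle, and it is
negative near both ends since `φ - ψ` is bounded near `0` and grows at most linearly. -/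
theorem solution_le (hp : p.Admissible) {φ ψ : ℝ → ℝ} (hφ : p.IsSolution φ)
    (hψ : p.IsSolution ψ) {D : ℝ} (hD : 0 < D) : φ D ≤ ψ D := by
  obtain ⟨C, hC, hB⟩ := hp.exists_barrier
  have hσ := hp.σ_pos
  have hlam := hp.lam_pos
  set B : ℝ → ℝ := fun D => D ^ 2 - Real.log D + C with hBdef
  have hmain : ∀ ε : ℝ, 0 < ε → φ D - ψ D - ε * B D ≤ 0 := by
    intro ε hε
    have d1 : ∀ x ∈ Ioi (0 : ℝ), HasDerivAt (fun x => φ x - ψ x - ε * B x)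
        (deriv φ x - deriv ψ x - ε * (2 * x - 1 / x)) x := by
      intro x hx
      have h1 : HasDerivAt B (2 * x - 1 / x) x := by
        refine ((((hasDerivAt_pow 2 x).sub (Real.hasDerivAt_log (ne_of_gt hx))).add_const
          C)).congr_deriv ?_
        simp
      exact ((hφ.contDiffOn.hasDerivAt_deriv isOpen_Ioi hx).1.sub
        (hψ.contDiffOn.hasDerivAt_deriv isOpen_Ioi hx).1).sub (h1.const_mul ε)
    have d2 : ∀ x ∈ Ioi (0 : ℝ), HasDerivAt
        (fun x => deriv φ x - deriv ψ x - ε * (2 * x - 1 / x))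
        (deriv (deriv φ) x - deriv (deriv ψ) x - ε * (2 + 1 / x ^ 2)) x := by
      intro x hx
      have h1 : HasDerivAt (fun x : ℝ => 2 * x - 1 / x) (2 + 1 / x ^ 2) x := by
        have := ((hasDerivAt_id x).const_mul 2).sub (hasDerivAt_inv (ne_of_gt hx))
        simp only [one_div]
        exact this.congr_deriv (by ring)
      exact ((hφ.contDiffOn.hasDerivAt_deriv isOpen_Ioi hx).2.sub
        (hψ.contDiffOn.hasDerivAt_deriv isOpen_Ioi hx).2).sub (h1.const_mul ε)
    refine nonpos_of_deriv_deriv_pos (g := fun x => φ x - ψ x - ε * B x)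
      (fun x hx => (d1 x hx).continuousAt.continuousWithinAt) ?_ ?_ ?_ hD
    · obtain ⟨c, hc⟩ := hφ.finite_at_zero
      obtain ⟨d, hd⟩ := hψ.finite_at_zero
      have hpow : Tendsto (fun x : ℝ => x ^ 2 + C) (𝓝[>] 0) (𝓝 (0 ^ 2 + C)) :=
        ((continuous_pow 2).add continuous_const).continuousWithinAt
      have hBtop : Tendsto B (𝓝[>] 0) atTop := by
        refine (hpow.add_atTop (tendsto_neg_atBot_atTop.comp
          Real.tendsto_log_nhdsGT_zero)).congr fun x => ?_
        simp only [hBdef, Function.comp_apply]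
        ring
      have := (hc.sub hd).add_atBot (tendsto_neg_atTop_atBot.comp (hBtop.const_mul_atTop hε))
      filter_upwards [this.eventually_le_atBot 0] with x hx
      simpa [sub_eq_add_neg] using hx
    · have h0 : (fun x : ℝ => x) =o[atTop] fun x : ℝ => x ^ 2 := by
        simpa using isLittleO_pow_pow_atTop_of_lt (𝕜 := ℝ) one_lt_two
      have h1 : (fun x => φ x - ψ x) =o[atTop] fun x : ℝ => x ^ 2 :=
        (hφ.linear_growth.sub hψ.linear_growth).trans_isLittleO h0
      have h2 : Real.log =o[atTop] fun x : ℝ => x ^ 2 := Real.isLittleO_log_id_atTop.trans h0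
      filter_upwards [h1.bound (half_pos hε), h2.bound one_half_pos] with x hx1 hx2
      simp only [norm_pow, Real.norm_eq_abs, sq_abs] at hx1 hx2
      have := mul_le_mul_of_nonneg_left (show x ^ 2 - 1 / 2 * x ^ 2 ≤ B x by
        simp only [hBdef]; linarith [le_abs_self (Real.log x)]) hε.le
      linarith [le_abs_self (φ x - ψ x)]
    · intro x hx hgx hg'
      rw [deriv_deriv_eq_of_hasDerivAt isOpen_Ioi d1 d2 hx]
      rw [(d1 x hx).deriv] at hg'
      have o1 := hφ.ode x hx
      have o2 := hψ.ode x hx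
      have o3 := mul_le_mul_of_nonneg_left (hB x hx) hε.le
      rw [← drift] at o1 o2
      have o4 : deriv φ x - deriv ψ x = ε * (2 * x - 1 / x) := by linarith
      have hpos : 0 < 1 / 2 * p.σ ^ 2 * x *
          (deriv (deriv φ) x - deriv (deriv ψ) x - ε * (2 + 1 / x ^ 2)) := by
        have e : 1 / 2 * p.σ ^ 2 * x *
          (deriv (deriv φ) x - deriv (deriv ψ) x - ε * (2 + 1 / x ^ 2)) =
          p.lam * (φ x - ψ x - ε * B x) - ε * (p.drift x * (2 * x - 1 / x) +
            1 / 2 * p.σ ^ 2 * x * (2 + 1 / x ^ 2) - p.lam * B x) := by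
          linear_combination o1 - o2 - p.drift x * o4
        rw [e]
        have := mul_pos hlam hgx
        simp only [hBdef] at this ⊢
        linarith
      exact (pos_iff_pos_of_mul_pos hpos).1 (by positivity)
  -- A positive difference at `D` would exceed `ε * B D` for this `ε`.
  by_contra! hlt
  have hε : 0 < (φ D - ψ D) / (2 * (|B D| + 1)) := div_pos (by linarith) (by positivity)
  have h1 := hmain _ hε
  have h2 : (φ D - ψ D) / (2 * (|B D| + 1)) * B D ≤
      (φ D - ψ D) / (2 * (|B D| + 1)) * (|B D| + 1) := by
    gcongr
    linarith [le_abs_self (B D)]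
  have h3 : (φ D - ψ D) / (2 * (|B D| + 1)) * (|B D| + 1) = (φ D - ψ D) / 2 := by
    have : |B D| + 1 ≠ 0 := by positivity
    field_simp
  linarith

end Admissible

/-! ### The derivatives of `m`, `u` and `Phi` -/

/-- The derivative of `p.m`. -/
def mDeriv (p : DividendModel) (D : ℝ) : ℝ :=
  p.lam / (p.κ₁ * p.θ₁) * kummerM (p.a₁ + 1) (p.b₁ + 1) (p.x₁ D)

/-- The second derivative of `p.m`. -/
def mDeriv₂ (p : DividendModel) (D : ℝ) : ℝ :=
  p.lam / (p.κ₁ * p.θ₁) * ((p.a₁ + 1) / (p.b₁ + 1) *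
    kummerM (p.a₁ + 1 + 1) (p.b₁ + 1 + 1) (p.x₁ D) * (2 * p.κ₁ / p.σ ^ 2))

/-- The derivative of `p.u` on `(0, ∞)`. -/
def uDeriv (p : DividendModel) (D : ℝ) : ℝ :=
  -(2 * p.lam / p.σ ^ 2) * tricomiU (p.a₂ + 1) (p.b₂ + 1) (p.x₂ D)

/-- The second derivative of `p.u` on `(0, ∞)`. -/
def uDeriv₂ (p : DividendModel) (D : ℝ) : ℝ :=
  2 * p.lam / p.σ ^ 2 * ((p.a₂ + 1) * tricomiU (p.a₂ + 1 + 1) (p.b₂ + 1 + 1) (p.x₂ D) *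
    (2 * p.κ₂ / p.σ ^ 2))

/-- The derivative of `p.Phi` on `(0, ∞)`; its two branches agree at the threshold. -/
def PhiDeriv (p : DividendModel) (D : ℝ) : ℝ :=
  if D ≤ p.threshold then 1 / (p.lam + p.κ₁) + p.E * p.mDeriv D
  else 1 / (p.lam + p.κ₂) + p.F * p.uDeriv D

/-- The second derivative of `p.Phi` on `(0, ∞)`; its two branches agree at the threshold. -/
def PhiDeriv₂ (p : DividendModel) (D : ℝ) : ℝ :=
  if D ≤ p.threshold then p.E * p.mDeriv₂ D else p.F * p.uDeriv₂ D

theorem hasDerivAt_x₁ (p : DividendModel) (D : ℝ) : HasDerivAt p.x₁ (2 * p.κ₁ / p.σ ^ 2) D :=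
  (((hasDerivAt_id D).const_mul (2 * p.κ₁)).div_const (p.σ ^ 2)).congr_deriv (by ring)

theorem hasDerivAt_x₂ (p : DividendModel) (D : ℝ) : HasDerivAt p.x₂ (2 * p.κ₂ / p.σ ^ 2) D :=
  (((hasDerivAt_id D).const_mul (2 * p.κ₂)).div_const (p.σ ^ 2)).congr_deriv (by ring)

namespace Admissible

variable {p : DividendModel}

theorem κ₁_pos (hp : p.Admissible) : 0 < p.κ₁ := hp.κ₂_pos.trans hp.κ_lt

theorem θ₂_pos (hp : p.Admissible) : 0 < p.θ₂ := hp.θ₁_pos.trans_le hp.θ_le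

theorem a₁_pos (hp : p.Admissible) : 0 < p.a₁ := div_pos hp.lam_pos hp.κ₁_pos

theorem a₂_pos (hp : p.Admissible) : 0 < p.a₂ := div_pos hp.lam_pos hp.κ₂_pos

theorem b₁_pos (hp : p.Admissible) : 0 < p.b₁ := by
  have := hp.κ₁_pos; have := hp.θ₁_pos; have := hp.σ_pos
  unfold b₁; positivity

theorem x₁_pos (hp : p.Admissible) {D : ℝ} (hD : 0 < D) : 0 < p.x₁ D := by
  have := hp.κ₁_pos; have := hp.σ_pos
  unfold x₁; positivity

theorem x₂_pos (hp : p.Admissible) {D : ℝ} (hD : 0 < D) : 0 < p.x₂ D := by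
  have := hp.κ₂_pos; have := hp.σ_pos
  unfold x₂; positivity

theorem threshold_pos (hp : p.Admissible) : 0 < p.threshold :=
  div_pos (sub_pos.2 hp.κθ_lt) (sub_pos.2 hp.κ_lt)

theorem threshold_mul (hp : p.Admissible) :
    p.threshold * (p.κ₁ - p.κ₂) = p.κ₁ * p.θ₁ - p.κ₂ * p.θ₂ :=
  div_mul_cancel₀ _ (sub_pos.2 hp.κ_lt).ne'

theorem drift_of_le (hp : p.Admissible) {D : ℝ} (hD : D ≤ p.threshold) :
    p.drift D = p.κ₁ * (p.θ₁ - D) := by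
  refine max_eq_left ?_
  have := mul_le_mul_of_nonneg_right hD (sub_pos.2 hp.κ_lt).le
  linarith [hp.threshold_mul]

theorem drift_of_ge (hp : p.Admissible) {D : ℝ} (hD : p.threshold ≤ D) :
    p.drift D = p.κ₂ * (p.θ₂ - D) := by
  refine max_eq_right ?_
  have := mul_le_mul_of_nonneg_right hD (sub_pos.2 hp.κ_lt).le
  linarith [hp.threshold_mul]

theorem m_pos (hp : p.Admissible) {D : ℝ} (hD : 0 < D) : 0 < p.m D :=
  kummerM_pos hp.a₁_pos hp.b₁_pos (hp.x₁_pos hD).le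

theorem u_pos (hp : p.Admissible) {D : ℝ} (hD : 0 < D) : 0 < p.u D :=
  tricomiU_pos hp.a₂_pos _ (hp.x₂_pos hD)

theorem mDeriv₂_pos (hp : p.Admissible) {D : ℝ} (hD : 0 < D) : 0 < p.mDeriv₂ D := by
  have := hp.κ₁_pos; have := hp.θ₁_pos; have := hp.σ_pos; have := hp.lam_pos
  have ha := hp.a₁_pos; have hb := hp.b₁_pos
  have := kummerM_pos (a := p.a₁ + 1 + 1) (b := p.b₁ + 1 + 1) (by positivity) (by positivity)
    (hp.x₁_pos hD).le
  unfold mDeriv₂; positivity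

theorem hasDerivAt_m (hp : p.Admissible) (D : ℝ) : HasDerivAt p.m (p.mDeriv D) D := by
  refine ((hasDerivAt_kummerM hp.a₁_pos hp.b₁_pos _).comp D (hasDerivAt_x₁ p D)).congr_deriv ?_
  have := hp.κ₁_pos; have := hp.θ₁_pos; have := hp.σ_pos
  have e : p.a₁ / p.b₁ * (2 * p.κ₁ / p.σ ^ 2) = p.lam / (p.κ₁ * p.θ₁) := by
    unfold a₁ b₁; field_simp
  rw [mDeriv, ← e]
  ring

theorem hasDerivAt_mDeriv (hp : p.Admissible) (D : ℝ) :
    HasDerivAt p.mDeriv (p.mDeriv₂ D) D := by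
  have ha := hp.a₁_pos; have hb := hp.b₁_pos
  exact ((hasDerivAt_kummerM (a := p.a₁ + 1) (b := p.b₁ + 1) (by positivity) (by positivity)
    _).comp D (hasDerivAt_x₁ p D)).const_mul _

theorem hasDerivAt_u (hp : p.Admissible) {D : ℝ} (hD : 0 < D) :
    HasDerivAt p.u (p.uDeriv D) D := by
  refine ((hasDerivAt_tricomiU hp.a₂_pos _ (hp.x₂_pos hD)).comp D
    (hasDerivAt_x₂ p D)).congr_deriv ?_
  have := hp.κ₂_pos; have := hp.σ_pos
  have e : p.a₂ * (2 * p.κ₂ / p.σ ^ 2) = 2 * p.lam / p.σ ^ 2 := by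
    unfold a₂; field_simp
  rw [uDeriv, ← e]
  ring

theorem hasDerivAt_uDeriv (hp : p.Admissible) {D : ℝ} (hD : 0 < D) :
    HasDerivAt p.uDeriv (p.uDeriv₂ D) D := by
  have ha := hp.a₂_pos
  refine (((hasDerivAt_tricomiU (a := p.a₂ + 1) (by positivity) (p.b₂ + 1) (hp.x₂_pos hD)).comp D
    (hasDerivAt_x₂ p D)).const_mul _).congr_deriv ?_
  rw [uDeriv₂]
  ring

theorem m_ode (hp : p.Admissible) (D : ℝ) :
    p.κ₁ * (p.θ₁ - D) * p.mDeriv D + 1 / 2 * p.σ ^ 2 * D * p.mDeriv₂ D - p.lam * p.m D = 0 := by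
  have h := kummerM_ode hp.a₁_pos hp.b₁_pos (p.x₁ D)
  have := hp.κ₁_pos.ne'; have := hp.θ₁_pos.ne'; have := hp.σ_pos.ne'
  rw [m, mDeriv, mDeriv₂]
  generalize kummerM p.a₁ p.b₁ (p.x₁ D) = k0 at *
  generalize kummerM (p.a₁ + 1) (p.b₁ + 1) (p.x₁ D) = k1 at *
  generalize (p.a₁ + 1) / (p.b₁ + 1) * kummerM (p.a₁ + 1 + 1) (p.b₁ + 1 + 1) (p.x₁ D) = k2 at *
  rw [x₁, a₁, b₁] at h
  field_simp at h ⊢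
  linear_combination h

theorem u_ode (hp : p.Admissible) {D : ℝ} (hD : 0 < D) :
    p.κ₂ * (p.θ₂ - D) * p.uDeriv D + 1 / 2 * p.σ ^ 2 * D * p.uDeriv₂ D - p.lam * p.u D = 0 := by
  have h := tricomiU_ode hp.a₂_pos p.b₂ (hp.x₂_pos hD)
  have := hp.κ₂_pos.ne'; have := hp.σ_pos.ne'
  rw [u, uDeriv, uDeriv₂]
  generalize tricomiU p.a₂ p.b₂ (p.x₂ D) = k0 at *
  generalize tricomiU (p.a₂ + 1) (p.b₂ + 1) (p.x₂ D) = k1 at *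
  generalize (p.a₂ + 1) * tricomiU (p.a₂ + 1 + 1) (p.b₂ + 1 + 1) (p.x₂ D) = k2 at *
  rw [x₂, a₂, b₂] at h
  field_simp at h ⊢
  linear_combination h

theorem tendsto_u_atTop (hp : p.Admissible) : Tendsto p.u atTop (𝓝 0) := by
  refine (tendsto_tricomiU_atTop hp.a₂_pos p.b₂).comp ?_
  have := hp.κ₂_pos; have := hp.σ_pos
  exact (tendsto_id.const_mul_atTop (by positivity : 0 < 2 * p.κ₂)).atTop_div_const (by positivity)

/-! ### The constants and the matching at the threshold -/

theorem m₁_pos (hp : p.Admissible) : 0 < p.m₁ := hp.m_pos hp.threshold_pos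

theorem u₂_pos (hp : p.Admissible) : 0 < p.u₂ := hp.u_pos hp.threshold_pos

theorem M₁_pos (hp : p.Admissible) : 0 < p.M₁ := by
  have ha := hp.a₁_pos; have hb := hp.b₁_pos
  exact kummerM_pos (by positivity) (by positivity) (hp.x₁_pos hp.threshold_pos).le

theorem U₂_pos (hp : p.Admissible) : 0 < p.U₂ := by
  have ha := hp.a₂_pos
  exact tricomiU_pos (by positivity) _ (hp.x₂_pos hp.threshold_pos)

theorem A_pos (hp : p.Admissible) : 0 < p.A := by
  have := hp.m₁_pos; have := hp.u₂_pos; have := hp.M₁_pos; have := hp.U₂_pos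
  have := hp.κ₁_pos; have := hp.θ₁_pos; have := hp.σ_pos
  unfold A; positivity

theorem E_pos (hp : p.Admissible) : 0 < p.E := by
  have := hp.A_pos; have := hp.U₂_pos
  have := hp.κ₁_pos; have := hp.κ₂_pos; have := hp.lam_pos; have := hp.σ_pos
  refine div_pos ?_ (by positivity)
  have h1 := mul_pos hp.u₂_pos (sub_pos.2 hp.κ_lt)
  have h2 : 0 ≤ 2 * p.U₂ * p.κ₁ * p.κ₂ * (p.θ₂ - p.θ₁) / p.σ ^ 2 := by
    have := sub_nonneg.2 hp.θ_le
    positivity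
  have h3 : 2 * p.U₂ * p.κ₁ * p.κ₂ * (p.θ₂ - p.θ₁) / p.σ ^ 2 =
    -(2 * p.U₂ * p.κ₁ * p.κ₂ * (p.θ₁ - p.θ₂) / p.σ ^ 2) := by ring
  linarith

/-- Positivity of `F` comes from the convexity of `m`: at the threshold, Kummer's equation gives
`lam * m - drift * m' = σ² D m'' / 2 > 0`. -/
theorem F_pos (hp : p.Admissible) : 0 < p.F := by
  have := hp.A_pos
  have hκ₁ := hp.κ₁_pos; have := hp.κ₂_pos; have hlam := hp.lam_pos; have hσ := hp.σ_pos
  have hθ₁ := hp.θ₁_pos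
  refine div_pos ?_ (by positivity)
  have h1 := hp.m_ode p.threshold
  have h2 : 0 < 1 / 2 * p.σ ^ 2 * p.threshold * p.mDeriv₂ p.threshold := by
    have := hp.threshold_pos; have := hp.mDeriv₂_pos hp.threshold_pos
    positivity
  have h3 : p.κ₁ * (p.θ₁ - p.threshold) * p.mDeriv p.threshold =
      p.lam * ((p.θ₁ - p.threshold) / p.θ₁ * p.M₁) := by
    rw [mDeriv, ← M₁]; field_simp
  have h4 : (p.θ₁ - p.threshold) / p.θ₁ * p.M₁ < p.m₁ := by
    refine lt_of_mul_lt_mul_left ?_ hlam.le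
    have : p.m p.threshold = p.m₁ := rfl
    rw [this] at h1
    linarith
  have h5 := mul_lt_mul_of_pos_right h4 (sub_pos.2 hp.κ_lt)
  have h6 : (p.θ₁ - p.threshold) / p.θ₁ * p.M₁ * (p.κ₁ - p.κ₂) =
      -(p.M₁ * p.κ₂ * ((p.θ₁ - p.θ₂) / p.θ₁)) := by
    field_simp
    linear_combination -p.M₁ * hp.threshold_mul
  linarith

/-- The linear system for `E` and `F`: the jumps of the particular solutions and of their
derivatives at the threshold are compensated by the multiples of `m` and `u`. -/
theorem E_mul_sub_F_mul (hp : p.Admissible) :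
    p.E * p.m₁ - p.F * p.u₂ =
        p.κ₁ * p.κ₂ * (p.θ₂ - p.θ₁) / (p.lam * (p.lam + p.κ₁) * (p.lam + p.κ₂)) ∧
      p.E * (p.lam / (p.κ₁ * p.θ₁) * p.M₁) - p.F * (-(2 * p.lam / p.σ ^ 2) * p.U₂) =
        (p.κ₁ - p.κ₂) / ((p.lam + p.κ₁) * (p.lam + p.κ₂)) := by
  have hA := hp.A_pos.ne'
  have := hp.κ₁_pos; have := hp.κ₂_pos; have := hp.lam_pos; have := hp.σ_pos
  have := hp.θ₁_pos
  have hE : p.E = (p.u₂ * (p.κ₁ - p.κ₂) - 2 * p.U₂ * p.κ₁ * p.κ₂ * (p.θ₁ - p.θ₂) / p.σ ^ 2) /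
    (p.lam * (p.lam + p.κ₁) * (p.lam + p.κ₂)) / p.A := by rw [E, div_div]
  have hF : p.F = (p.M₁ * p.κ₂ * ((p.θ₁ - p.θ₂) / p.θ₁) + p.m₁ * (p.κ₁ - p.κ₂)) /
    (p.lam * (p.lam + p.κ₁) * (p.lam + p.κ₂)) / p.A := by rw [F, div_div]
  constructor
  · rw [← mul_left_inj' hA, sub_mul, mul_right_comm, mul_right_comm p.F, hE, hF,
      div_mul_cancel₀ _ hA, div_mul_cancel₀ _ hA, A]
    field_simp
    ring
  · rw [← mul_left_inj' hA, sub_mul, mul_right_comm, mul_right_comm p.F, hE, hF,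
      div_mul_cancel₀ _ hA, div_mul_cancel₀ _ hA, A]
    field_simp
    ring

theorem value_match (hp : p.Admissible) :
    p.intrinsic₁ p.threshold + p.E * p.m p.threshold =
      p.intrinsic₂ p.threshold + p.F * p.u p.threshold := by
  have h := hp.E_mul_sub_F_mul.1
  have := hp.κ₁_pos; have := hp.κ₂_pos; have := hp.lam_pos
  have e : p.intrinsic₂ p.threshold - p.intrinsic₁ p.threshold =
      p.κ₁ * p.κ₂ * (p.θ₂ - p.θ₁) / (p.lam * (p.lam + p.κ₁) * (p.lam + p.κ₂)) := by
    unfold intrinsic₁ intrinsic₂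
    field_simp
    linear_combination p.lam * hp.threshold_mul
  have h1 : p.m p.threshold = p.m₁ := rfl
  have h2 : p.u p.threshold = p.u₂ := rfl
  rw [h1, h2]
  linarith

theorem deriv_match (hp : p.Admissible) :
    1 / (p.lam + p.κ₁) + p.E * p.mDeriv p.threshold =
      1 / (p.lam + p.κ₂) + p.F * p.uDeriv p.threshold := by
  have h := hp.E_mul_sub_F_mul.2
  have := hp.κ₁_pos; have := hp.κ₂_pos; have := hp.lam_pos
  have e : 1 / (p.lam + p.κ₂) - 1 / (p.lam + p.κ₁) =
      (p.κ₁ - p.κ₂) / ((p.lam + p.κ₁) * (p.lam + p.κ₂)) := by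
    field_simp
    ring
  rw [mDeriv, uDeriv, ← M₁, ← U₂]
  linarith

theorem left_ode (hp : p.Admissible) (D : ℝ) :
    p.κ₁ * (p.θ₁ - D) * (1 / (p.lam + p.κ₁) + p.E * p.mDeriv D)
      + 1 / 2 * p.σ ^ 2 * D * (p.E * p.mDeriv₂ D)
      - p.lam * (p.intrinsic₁ D + p.E * p.m D) + D = 0 := by
  have := hp.κ₁_pos; have := hp.lam_pos
  have e : p.κ₁ * (p.θ₁ - D) * (1 / (p.lam + p.κ₁)) - p.lam * p.intrinsic₁ D + D = 0 := by
    unfold intrinsic₁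
    field_simp
    ring
  linear_combination e + p.E * hp.m_ode D

theorem right_ode (hp : p.Admissible) {D : ℝ} (hD : 0 < D) :
    p.κ₂ * (p.θ₂ - D) * (1 / (p.lam + p.κ₂) + p.F * p.uDeriv D)
      + 1 / 2 * p.σ ^ 2 * D * (p.F * p.uDeriv₂ D)
      - p.lam * (p.intrinsic₂ D + p.F * p.u D) + D = 0 := by
  have := hp.κ₂_pos; have := hp.lam_pos
  have e : p.κ₂ * (p.θ₂ - D) * (1 / (p.lam + p.κ₂)) - p.lam * p.intrinsic₂ D + D = 0 := by
    unfold intrinsic₂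
    field_simp
    ring
  linear_combination e + p.F * hp.u_ode hD

/-- The second derivatives match for free: both branches solve the same equation at the threshold,
where the drifts coincide. -/
theorem deriv₂_match (hp : p.Admissible) :
    p.E * p.mDeriv₂ p.threshold = p.F * p.uDeriv₂ p.threshold := by
  have h1 := hp.left_ode p.threshold
  have h2 := hp.right_ode hp.threshold_pos
  have hd := (hp.drift_of_le le_rfl).symm.trans (hp.drift_of_ge le_rfl)
  rw [hp.value_match, hp.deriv_match, hd] at h1
  have hpos : 1 / 2 * p.σ ^ 2 * p.threshold ≠ 0 := by
    have := hp.σ_pos; have := hp.threshold_pos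
    positivity
  exact mul_left_cancel₀ hpos (by linarith)

/-! ### Regularity and growth of `Phi` -/

theorem hasDerivAt_left (hp : p.Admissible) (D : ℝ) :
    HasDerivAt (fun D => p.intrinsic₁ D + p.E * p.m D)
      (1 / (p.lam + p.κ₁) + p.E * p.mDeriv D) D :=
  (((hasDerivAt_id D).div_const _).add_const _).add ((hp.hasDerivAt_m D).const_mul _)

theorem hasDerivAt_right (hp : p.Admissible) {D : ℝ} (hD : 0 < D) :
    HasDerivAt (fun D => p.intrinsic₂ D + p.F * p.u D)
      (1 / (p.lam + p.κ₂) + p.F * p.uDeriv D) D :=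
  (((hasDerivAt_id D).div_const _).add_const _).add ((hp.hasDerivAt_u hD).const_mul _)

theorem hasDerivAt_Phi (hp : p.Admissible) {D : ℝ} (hD : 0 < D) :
    HasDerivAt p.Phi (p.PhiDeriv D) D :=
  HasDerivAt.ite_le (f' := fun D => 1 / (p.lam + p.κ₁) + p.E * p.mDeriv D)
    (g' := fun D => 1 / (p.lam + p.κ₂) + p.F * p.uDeriv D)
    (hp.hasDerivAt_left D) (hp.hasDerivAt_right hD) hp.value_match hp.deriv_match

theorem hasDerivAt_PhiDeriv (hp : p.Admissible) {D : ℝ} (hD : 0 < D) :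
    HasDerivAt p.PhiDeriv (p.PhiDeriv₂ D) D :=
  HasDerivAt.ite_le (f' := fun D => p.E * p.mDeriv₂ D) (g' := fun D => p.F * p.uDeriv₂ D)
    (((hp.hasDerivAt_mDeriv D).const_mul p.E).const_add _)
    (((hp.hasDerivAt_uDeriv hD).const_mul p.F).const_add _) hp.deriv_match hp.deriv₂_match

theorem Phi_ode (hp : p.Admissible) {D : ℝ} (hD : 0 < D) :
    p.drift D * p.PhiDeriv D + 1 / 2 * p.σ ^ 2 * D * p.PhiDeriv₂ D - p.lam * p.Phi D + D = 0 := by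
  unfold Phi PhiDeriv PhiDeriv₂
  split_ifs with h
  · rw [hp.drift_of_le h]
    exact hp.left_ode D
  · rw [hp.drift_of_ge (le_of_not_ge h)]
    exact hp.right_ode hD

theorem continuousOn_PhiDeriv₂ (hp : p.Admissible) : ContinuousOn p.PhiDeriv₂ (Ioi 0) := by
  have hσ := hp.σ_pos
  have h0 : ContinuousOn p.Phi (Ioi 0) :=
    fun D hD => (hp.hasDerivAt_Phi hD).continuousAt.continuousWithinAt
  have h1 : ContinuousOn p.PhiDeriv (Ioi 0) :=
    fun D hD => (hp.hasDerivAt_PhiDeriv hD).continuousAt.continuousWithinAt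
  have hd : Continuous p.drift := by unfold drift; fun_prop
  -- The equation expresses the second derivative by continuous functions.
  have hc : ContinuousOn (fun D => (p.lam * p.Phi D - D - p.drift D * p.PhiDeriv D) /
      (1 / 2 * p.σ ^ 2 * D)) (Ioi 0) := by
    refine ContinuousOn.div (((continuousOn_const.mul h0).sub continuousOn_id).sub
      (hd.continuousOn.mul h1)) (by fun_prop) fun D hD => ?_
    have : (0 : ℝ) < D := hD
    positivity
  refine hc.congr fun D hD => ?_
  have hD' : (0 : ℝ) < D := hD
  rw [eq_div_iff (by positivity)]
  linarith [hp.Phi_ode hD']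

theorem Phi_pos (hp : p.Admissible) {D : ℝ} (hD : 0 < D) : 0 < p.Phi D := by
  have := hp.E_pos; have := hp.F_pos; have := hp.m_pos hD; have := hp.u_pos hD
  have := hp.κ₁_pos; have := hp.κ₂_pos; have := hp.lam_pos; have := hp.θ₁_pos
  have := hp.θ₂_pos
  unfold Phi intrinsic₁ intrinsic₂
  split_ifs <;> positivity

theorem tendsto_Phi_sub_intrinsic₂ (hp : p.Admissible) :
    Tendsto (fun D => p.Phi D - p.intrinsic₂ D) atTop (𝓝 0) := by
  have h := hp.tendsto_u_atTop.const_mul p.F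
  rw [mul_zero] at h
  refine h.congr' ?_
  filter_upwards [eventually_gt_atTop p.threshold] with D hD
  rw [Phi, if_neg hD.not_ge]
  ring

theorem isSolution_Phi (hp : p.Admissible) : p.IsSolution p.Phi where
  pos D hD := hp.Phi_pos hD
  contDiffOn := contDiffOn_two_of_hasDerivAt isOpen_Ioi (fun _ hD => hp.hasDerivAt_Phi hD)
    (fun _ hD => hp.hasDerivAt_PhiDeriv hD) hp.continuousOn_PhiDeriv₂
  ode D hD := by
    rw [(hp.hasDerivAt_Phi hD).deriv, deriv_deriv_eq_of_hasDerivAt isOpen_Ioi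
      (fun _ hD => hp.hasDerivAt_Phi hD) (fun _ hD => hp.hasDerivAt_PhiDeriv hD) (mem_Ioi.2 hD)]
    exact hp.Phi_ode hD
  finite_at_zero := by
    refine ⟨_, ((hp.hasDerivAt_left 0).continuousAt.tendsto.mono_left
      nhdsWithin_le_nhds).congr' ?_⟩
    filter_upwards [Ioo_mem_nhdsGT hp.threshold_pos] with D hD
    rw [Phi, if_pos hD.2.le]
  linear_growth := by
    have h1 : (fun _ : ℝ => (1 : ℝ)) =O[atTop] fun D : ℝ => D :=
      (isLittleO_const_id_atTop (1 : ℝ)).isBigO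
    have h2 := (hp.tendsto_Phi_sub_intrinsic₂.isBigO_one ℝ).trans h1
    have h3 : p.intrinsic₂ =O[atTop] fun D : ℝ => D := by
      refine IsBigO.add ?_ ((isBigO_const_const _ one_ne_zero _).trans h1)
      simp only [div_eq_inv_mul]
      exact isBigO_const_mul_self _ _ _
    simpa using h2.add h3

end Admissible
end DividendModel

end

theorem theorem5p1 (p : DividendModel)
    (hκ₂ : 0 < p.κ₂) (hκ : p.κ₂ < p.κ₁)
    (hθ₁ : 0 < p.θ₁) (hθ : p.θ₁ ≤ p.θ₂)
    (hκθ : p.κ₂ * p.θ₂ < p.κ₁ * p.θ₁)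
    (hσ : 0 < p.σ) (hlam : 0 < p.lam)
    (hb₁ : 1 ≤ 2 * p.κ₁ * p.θ₁ / p.σ ^ 2) (hb₂ : 1 ≤ 2 * p.κ₂ * p.θ₂ / p.σ ^ 2) :
    0 < p.E ∧ 0 < p.F ∧
    p.IsSolution p.Phi ∧
    Tendsto (fun D => p.Phi D - p.intrinsic₂ D) atTop (𝓝 0) ∧
    ∀ φ : ℝ → ℝ, p.IsSolution φ → EqOn φ p.Phi (Ioi 0) := by
  rw [one_le_div (by positivity)] at hb₁ hb₂
  have hp : p.Admissible := ⟨hκ₂, hκ, hθ₁, hθ, hκθ, hσ, hlam, hb₁, hb₂⟩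
  exact ⟨hp.E_pos, hp.F_pos, hp.isSolution_Phi, hp.tendsto_Phi_sub_intrinsic₂, fun φ hφ D hD =>
    le_antisymm (hp.solution_le hφ hp.isSolution_Phi hD) (hp.solution_le hp.isSolution_Phi hφ hD)⟩
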